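/- Let $\alpha$ be a real number with $1<\alpha<e^{1/e}$, and let ${}^0\alpha=1$, ${}^{n+1}\alpha=\alpha^{({}^n\alpha)}$ $(n\ge 0)$ be the natural exponential towers. Consider, for $\Re z>0$, the expression $${}^z\alpha=\frac{1}{\Gamma(1-z)}\left(\sum_{n=0}^\infty {}^{n+1}\alpha\,\frac{(-1)^n}{n!\,(n+1-z)}+\int_1^\infty\Big(\sum_{n=0}^\infty {}^{n+1}\alpha\,\frac{(-w)^n}{n!}\Big)w^{-z}\,dw\right).$$ The power series in $w$ converges absolutely for every $w\in\mathbb C$, the integral converges absolutely for all $\Re z>0$, and the first series converges absolutely for all $\Re z>0$ with $z\notin\{1,2,3,\dots\}$. The singularities of the expression at $z=1,2,3,\dots$ (where $1/\Gamma(1-z)$ has a zero and one term of the first series has a pole) are removable, so that it defines a function $z\mapsto{}^z\alpha$ holomorphic on $\Re z>0$. This function is a tetration function base $\alpha$: ${}^1\alpha=\alpha$ and ${}^{z+1}\alpha=\alpha^{({}^z\alpha)}=\exp\big(\log\alpha\cdot{}^z\alpha\big)$ for all $\Re z>0$; in particular its value at each integer $n\ge1$ is the natural tower ${}^n\alpha$.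 -/

import Mathlib

open MeasureTheory

noncomputable section

/-- The natural exponential towers `ⁿα`: `⁰α = 1` and `ⁿ⁺¹α = α ^ (ⁿα)`. -/
def natTower (α : ℝ) : ℕ → ℝ
  | 0 => 1
  | n + 1 => α ^ natTower α n

/-- The open right half plane `Re z > 0`. -/
def rightHalfPlane : Set ℂ := {z : ℂ | 0 < z.re}

/-- `F` is a tetration function base `α`: it is holomorphic on `Re z > 0`, `F 1 = α`, and
`F (z + 1) = α ^ F z` there. (For `α > 0` the complex power is `exp (log α * F z)` with the real
logarithm.) Values of `F` outside of the half plane play no role. -/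
structure IsTetrationFunction (α : ℝ) (F : ℂ → ℂ) : Prop where
  holomorphic : DifferentiableOn ℂ F rightHalfPlane
  map_one : F 1 = (α : ℂ)
  map_add_one : ∀ z ∈ rightHalfPlane, F (z + 1) = (α : ℂ) ^ F z

/-- The `n`-th term of the power series `∑ ⁿ⁺¹α (-w)ⁿ / n!`. -/
def auxTerm (α : ℝ) (w : ℂ) (n : ℕ) : ℂ :=
  (natTower α (n + 1) : ℂ) * ((-w) ^ n / (n.factorial : ℂ))

/-- The `n`-th term of the series `∑ ⁿ⁺¹α (-1)ⁿ / (n! (n + 1 - z))`. -/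
def poleTerm (α : ℝ) (z : ℂ) (n : ℕ) : ℂ :=
  (natTower α (n + 1) : ℂ) * ((-1) ^ n / ((n.factorial : ℂ) * ((n : ℂ) + 1 - z)))

/-- The integrand `(∑ ⁿ⁺¹α (-w)ⁿ / n!) w⁻ᶻ`, for real `w`. -/
def tailIntegrand (α : ℝ) (z : ℂ) (w : ℝ) : ℂ :=
  (∑' n : ℕ, auxTerm α (w : ℂ) n) * (w : ℂ) ^ (-z)

/-- The right-hand side of the formula for `ᶻα`. It is meaningful for `Re z > 0` except at
`z = 1, 2, 3, …`, where `1 / Γ (1 - z)` vanishes and one term of the series has a pole. -/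
def tetrationFormula (α : ℝ) (z : ℂ) : ℂ :=
  1 / Complex.Gamma (1 - z) *
    ((∑' n : ℕ, poleTerm α z n) + ∫ w in Set.Ioi (1 : ℝ), tailIntegrand α z w)

end

section

open Filter Topology Finset

/-! The map `x ↦ α ^ x` has a fixed point `ω` with multiplier `r = log α * ω` in `(0, 1)`. Writing a
tower as `ω * (1 - X)` turns exponentiation into `X ↦ 1 - exp (-r X)`, which is linearised at `0` by
the Koenigs series `H`, where `H (r t) = 1 - exp (-r H t)`. With `T` the limit of the rescaled orbit
of `1 - 1 / ω`, the towers are `ω * (1 - H (r ^ n * T)) = ∑ b k * (r ^ k) ^ n`, and the tetration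
function is obtained by replacing `n` with `z`.

The crux is that the series converges at `T` itself, with sum `1 - 1 / ω`. Differentiating the
Schröder equation gives a quadratic recursion that makes all coefficients nonnegative, so each
partial sum is a subsolution of the equation. A partial sum exceeding `1 - 1 / ω` at `T` would force
too large a rescaled limit, since distinct orbits stay a multiple of `r ^ n` apart
(`le_iterate_expStep_sub`, `koenigsPartial_le`). The same separation gives equality in
`koenigsFun_pow_mul`.

The formula is linear in the sequence of towers, and on `q ^ n` with `q = r ^ k` it gives `q ^ z`:
this is the Gamma integral split at `1` and continued in `s = 1 - z`
(`tsum_add_integral_Ioi_one_eq_Gamma`). Absolute summability of `b` then allows summation over `k`.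
-/

/-- The coefficients of the power series `H` with `H' 0 = 1` solving the Schröder equation
`H (r t) = 1 - exp (-r H t)`. -/
noncomputable def koenigsCoeff (r : ℝ) : ℕ → ℝ
  | 0 => 0
  | 1 => 1
  | k + 2 => (∑ i : Fin (k + 1), ((i : ℕ) + 1 : ℝ) * koenigsCoeff r (i + 1) *
      (r ^ (k + 1 - (i : ℕ)) * koenigsCoeff r (k + 1 - i))) / ((k + 2) * (1 - r ^ (k + 1)))
termination_by k => k
decreasing_by
  · have := i.2; omega
  · omega

/-! ### Koenigs coefficients and the partial sums as subsolutions -/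

section Koenigs

variable {r : ℝ}

theorem koenigsCoeff_zero : koenigsCoeff r 0 = 0 := by rw [koenigsCoeff]

theorem koenigsCoeff_one : koenigsCoeff r 1 = 1 := by rw [koenigsCoeff]

theorem koenigsCoeff_nonneg (h0 : 0 < r) (h1 : r < 1) (k : ℕ) : 0 ≤ koenigsCoeff r k := by
  induction k using Nat.strong_induction_on with
  | _ k ih =>
    match k with
    | 0 => rw [koenigsCoeff_zero]
    | 1 => rw [koenigsCoeff_one]; exact zero_le_one
    | k + 2 =>
      rw [koenigsCoeff]
      have : r ^ (k + 1) ≤ 1 := pow_le_one₀ h0.le h1.le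
      refine div_nonneg (Finset.sum_nonneg fun i _ => ?_)
        (mul_nonneg (by positivity) (by linarith))
      have := ih (i + 1) (by have := i.2; omega)
      have := ih (k + 1 - i) (by omega)
      positivity

/-- The coefficientwise form of `H' t = H' (r t) + H' t * H (r t)`. -/
theorem koenigsCoeff_rec (h0 : 0 < r) (h1 : r < 1) (k : ℕ) :
    (k + 1) * koenigsCoeff r (k + 1) = (k + 1) * koenigsCoeff r (k + 1) * r ^ k +
      ∑ p ∈ antidiagonal k, (p.1 + 1) * koenigsCoeff r (p.1 + 1) *
        (koenigsCoeff r p.2 * r ^ p.2) := by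
  match k with
  | 0 => simp [koenigsCoeff_zero]
  | k + 1 =>
    have h2 : r ^ (k + 1) < 1 := pow_lt_one₀ h0.le h1 (by omega)
    rw [Finset.Nat.sum_antidiagonal_eq_sum_range_succ_mk, Finset.sum_range_succ, Nat.sub_self,
      koenigsCoeff_zero, koenigsCoeff, Finset.sum_range]
    have h3 : (1 - r ^ (k + 1)) ≠ 0 := by linarith
    have h4 : ((k : ℝ) + 2) ≠ 0 := by positivity
    set S := ∑ i : Fin (k + 1), ((i : ℕ) + 1 : ℝ) * koenigsCoeff r (i + 1) *
      (r ^ (k + 1 - (i : ℕ)) * koenigsCoeff r (k + 1 - i)) with hS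
    have : ∑ i : Fin (k + 1), ((i : ℕ) + 1 : ℝ) * koenigsCoeff r (i + 1) *
      (koenigsCoeff r (k + 1 - i) * r ^ (k + 1 - (i : ℕ))) = S :=
      Finset.sum_congr rfl fun i _ => by ring
    rw [this]
    push_cast
    field_simp
    ring

/-- The index pairs on the left form a triangle contained in the rectangle on the right. -/
theorem sum_antidiagonal_le_mul_sum {f g : ℕ → ℝ} (hf : ∀ k, 0 ≤ f k) (hg : ∀ k, 0 ≤ g k)
    {N M : ℕ} (hNM : N ≤ M) :
    ∑ k ∈ range N, ∑ p ∈ antidiagonal k, f p.1 * g p.2 ≤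
      (∑ k ∈ range N, f k) * ∑ k ∈ range M, g k := by
  rw [Finset.sum_mul_sum, ← Finset.sum_product', Finset.sum_sigma']
  have hinj : Set.InjOn (fun x : (_ : ℕ) × ℕ × ℕ => x.2)
      ((range N).sigma fun k => antidiagonal k) := by
    rintro ⟨a, p⟩ ha ⟨b, q⟩ hb h
    simp only [coe_sigma, Set.mem_sigma_iff, mem_coe, HasAntidiagonal.mem_antidiagonal] at ha hb h
    subst h
    obtain rfl : a = b := by omega
    rfl
  rw [← Finset.sum_image (f := fun p : ℕ × ℕ => f p.1 * g p.2) hinj]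
  refine Finset.sum_le_sum_of_subset_of_nonneg ?_ fun p _ _ => mul_nonneg (hf _) (hg _)
  intro p hp
  simp only [mem_image, mem_sigma, mem_range, HasAntidiagonal.mem_antidiagonal] at hp
  obtain ⟨x, ⟨hx, hx'⟩, rfl⟩ := hp
  rw [mem_product, mem_range, mem_range]
  omega

/-- The partial sums of the power series with coefficients `koenigsCoeff r`. -/
noncomputable def koenigsPartial (r : ℝ) (N : ℕ) (t : ℝ) : ℝ :=
  ∑ k ∈ range (N + 1), koenigsCoeff r k * t ^ k

theorem hasDerivAt_koenigsPartial (N : ℕ) (t : ℝ) :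
    HasDerivAt (koenigsPartial r N)
      (∑ k ∈ range N, (k + 1) * koenigsCoeff r (k + 1) * t ^ k) t := by
  have h : HasDerivAt (fun t : ℝ => ∑ k ∈ range (N + 1), koenigsCoeff r k * t ^ k)
      (∑ k ∈ range (N + 1), koenigsCoeff r k * (k * t ^ (k - 1))) t :=
    HasDerivAt.fun_sum fun k _ => (hasDerivAt_pow k t).const_mul _
  convert! h using 1
  rw [Finset.sum_range_succ']
  simp only [Nat.cast_add, Nat.cast_one, Nat.cast_zero, zero_mul, mul_zero, add_zero,
    Nat.add_sub_cancel]
  exact Finset.sum_congr rfl fun k _ => by ring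

theorem koenigsPartial_zero (N : ℕ) : koenigsPartial r N 0 = 0 := by
  simp [koenigsPartial, Finset.sum_range_succ', koenigsCoeff_zero]

theorem deriv_koenigsPartial_le (h0 : 0 < r) (h1 : r < 1) (N : ℕ) {t : ℝ} (ht : 0 ≤ t) :
    ∑ k ∈ range N, (k + 1) * koenigsCoeff r (k + 1) * t ^ k ≤
      ∑ k ∈ range N, (k + 1) * koenigsCoeff r (k + 1) * (r * t) ^ k +
      (∑ k ∈ range N, (k + 1) * koenigsCoeff r (k + 1) * t ^ k) *
        koenigsPartial r N (r * t) := by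
  have hc := koenigsCoeff_nonneg h0 h1
  refine le_trans (le_of_eq ?_) (add_le_add_right (sum_antidiagonal_le_mul_sum
    (f := fun k => (k + 1) * koenigsCoeff r (k + 1) * t ^ k)
    (g := fun k => koenigsCoeff r k * (r * t) ^ k)
    (fun k => ?_) (fun k => ?_) (Nat.le_succ N)) _)
  · rw [← Finset.sum_add_distrib]
    refine Finset.sum_congr rfl fun k _ => ?_
    conv_lhs => rw [koenigsCoeff_rec h0 h1 k]
    rw [add_mul, Finset.sum_mul]
    congr 1
    · rw [mul_pow]; ring
    · refine Finset.sum_congr rfl fun p hp => ?_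
      rw [← HasAntidiagonal.mem_antidiagonal.1 hp, mul_pow, pow_add]
      ring
  · have := hc (k + 1)
    positivity
  · have := hc k
    positivity

/-- Truncation turns the Schröder equation into an inequality: the differential inequality
`deriv_koenigsPartial_le` integrates with the factor `exp (r * koenigsPartial r N t)`. -/
theorem one_sub_exp_le_koenigsPartial (h0 : 0 < r) (h1 : r < 1) (N : ℕ) {t : ℝ} (ht : 0 ≤ t) :
    1 - Real.exp (-(r * koenigsPartial r N t)) ≤ koenigsPartial r N (r * t) := by
  set φ : ℝ → ℝ := fun t =>
    (1 - koenigsPartial r N (r * t)) * Real.exp (r * koenigsPartial r N t) with hφ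
  have hd : ∀ t, HasDerivAt φ _ t := fun t =>
    ((((hasDerivAt_koenigsPartial N (r * t)).comp t
      ((hasDerivAt_id t).const_mul r))).const_sub 1).mul
      (((hasDerivAt_koenigsPartial N t).const_mul r).exp)
  -- The derivative of `φ` is `-r` times the exponential times the gap in `deriv_koenigsPartial_le`,
  -- and `φ 0 = 1`.
  have hanti : AntitoneOn φ (Set.Ici 0) := by
    refine antitoneOn_of_deriv_nonpos (convex_Ici 0)
      (fun t _ => (hd t).continuousAt.continuousWithinAt)
      (fun t _ => (hd t).differentiableAt.differentiableWithinAt) fun t ht => ?_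
    rw [interior_Ici] at ht
    rw [(hd t).deriv]
    have := deriv_koenigsPartial_le h0 h1 N (le_of_lt ht)
    have he := Real.exp_pos (r * koenigsPartial r N t)
    simp only [Function.comp]
    nlinarith [mul_nonneg (mul_pos he h0).le (sub_nonneg.2 this)]
  have h := hanti Set.self_mem_Ici (show (0 : ℝ) ≤ t from ht) ht
  simp only [hφ, mul_zero, koenigsPartial_zero, sub_zero, Real.exp_zero, mul_one] at h
  rw [← le_div_iff₀ (Real.exp_pos _), one_div, ← Real.exp_neg] at h
  linarith

end Koenigs

/-! ### Orbits of `expStep` at the scale `r ^ n` -/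

section Iteration

/-- The map `x ↦ 1 - exp (-r x)`, which has the fixed point `0` with multiplier `r`. -/
noncomputable def expStep (r x : ℝ) : ℝ := 1 - Real.exp (-(r * x))

variable {r : ℝ}

theorem expStep_le (x : ℝ) : expStep r x ≤ r * x := by
  have := Real.add_one_le_exp (-(r * x))
  rw [expStep]; linarith

theorem expStep_mono (h0 : 0 < r) : Monotone (expStep r) := fun x y h => by
  have : Real.exp (-(r * y)) ≤ Real.exp (-(r * x)) := Real.exp_le_exp.2 (by nlinarith)
  rw [expStep, expStep]; linarith

theorem iterate_expStep_le (h0 : 0 < r) (x : ℝ) (n : ℕ) :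
    (expStep r)^[n] x ≤ r ^ n * x := by
  induction n with
  | zero => simp
  | succ n ih =>
    rw [Function.iterate_succ_apply', pow_succ']
    exact (expStep_le _).trans (by nlinarith)

/-- Concavity: the tangent at `x` has slope `r * exp (-(r * x))` and lies above the graph. -/
theorem le_expStep_sub (x y : ℝ) :
    Real.exp (-(r * x)) * (r * (x - y)) ≤ expStep r x - expStep r y := by
  have h : Real.exp (-(r * y)) = Real.exp (-(r * x)) * Real.exp (r * (x - y)) := by
    rw [← Real.exp_add]; ring_nf
  rw [expStep, expStep, h]
  nlinarith [Real.add_one_le_exp (r * (x - y)), Real.exp_pos (-(r * x))]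

/-- The slopes along the orbit of `x` multiply to at least `r ^ n` times a constant independent of
`n`, because that orbit decays geometrically. -/
theorem le_iterate_expStep_sub (h0 : 0 < r) (h1 : r < 1) {x y : ℝ} (hx : 0 ≤ x) (hyx : y ≤ x)
    (n : ℕ) : r ^ n * ((x - y) * Real.exp (-(x / (1 - r)))) ≤
      (expStep r)^[n] x - (expStep r)^[n] y := by
  have key : r ^ n * ((x - y) * Real.exp (-(x * ∑ i ∈ range n, r ^ (i + 1)))) ≤
      (expStep r)^[n] x - (expStep r)^[n] y := by
    induction n with
    | zero => simp
    | succ n ih =>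
      rw [Function.iterate_succ_apply', Function.iterate_succ_apply']
      refine le_trans ?_ (le_expStep_sub _ _)
      rw [Finset.sum_range_succ, mul_add, neg_add, Real.exp_add]
      have h2 : Real.exp (-(x * r ^ (n + 1))) ≤ Real.exp (-(r * (expStep r)^[n] x)) := by
        refine Real.exp_le_exp.2 (neg_le_neg ?_)
        have := mul_le_mul_of_nonneg_left (iterate_expStep_le h0 x n) h0.le
        rw [pow_succ]; linarith
      calc r ^ (n + 1) * ((x - y) * (Real.exp (-(x * ∑ i ∈ range n, r ^ (i + 1))) *
              Real.exp (-(x * r ^ (n + 1)))))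
          = Real.exp (-(x * r ^ (n + 1))) * (r * (r ^ n * ((x - y) *
              Real.exp (-(x * ∑ i ∈ range n, r ^ (i + 1)))))) := by ring
        _ ≤ _ := by
          have h3 : 0 ≤ r ^ n * ((x - y) * Real.exp (-(x * ∑ i ∈ range n, r ^ (i + 1)))) :=
            mul_nonneg (by positivity) (mul_nonneg (by linarith) (Real.exp_pos _).le)
          gcongr
  refine le_trans ?_ key
  have hs : ∑ i ∈ range n, r ^ (i + 1) ≤ 1 / (1 - r) := by
    calc ∑ i ∈ range n, r ^ (i + 1) ≤ ∑ i ∈ range n, r ^ i :=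
          Finset.sum_le_sum fun i _ => pow_le_pow_of_le_one h0.le h1.le (Nat.le_succ i)
      _ ≤ ∑' i, r ^ i := (summable_geometric_of_lt_one h0.le h1).sum_le_tsum _
          fun i _ => by positivity
      _ = 1 / (1 - r) := by rw [tsum_geometric_of_lt_one h0.le h1, one_div]
  have : x * ∑ i ∈ range n, r ^ (i + 1) ≤ x / (1 - r) := by
    rw [← mul_one_div]; gcongr
  have h5 : 0 ≤ x - y := by linarith
  gcongr

/-- The rescaled iterates of `expStep r` converge to a positive limit. -/
theorem exists_tendsto_iterate_expStep (h0 : 0 < r) (h1 : r < 1) {x : ℝ} (hx : 0 < x) :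
    ∃ T, 0 < T ∧ Tendsto (fun n => (expStep r)^[n] x / r ^ n) atTop (𝓝 T) ∧
      ∀ n, r ^ n * T ≤ (expStep r)^[n] x := by
  have hanti : Antitone fun n => (expStep r)^[n] x / r ^ n := by
    refine antitone_nat_of_succ_le fun n => ?_
    rw [Function.iterate_succ_apply', div_le_div_iff₀ (by positivity) (by positivity), pow_succ']
    have := mul_le_mul_of_nonneg_right (expStep_le (r := r) ((expStep r)^[n] x))
      (pow_pos h0 n).le
    linarith
  set c := x * Real.exp (-(x / (1 - r))) with hc
  have hfix : ∀ n, (expStep r)^[n] 0 = 0 := fun n =>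
    Function.iterate_fixed (by simp [expStep]) n
  have hlow : ∀ n, c ≤ (expStep r)^[n] x / r ^ n := fun n => by
    rw [le_div_iff₀ (by positivity)]
    have := le_iterate_expStep_sub h0 h1 hx.le hx.le n
    rw [hfix] at this
    linarith
  have hb : BddBelow (Set.range fun n => (expStep r)^[n] x / r ^ n) :=
    ⟨c, by rintro _ ⟨n, rfl⟩; exact hlow n⟩
  have hlim := tendsto_atTop_ciInf hanti hb
  refine ⟨_, ?_, hlim, fun n => ?_⟩
  · exact lt_of_lt_of_le (mul_pos hx (Real.exp_pos _)) (ge_of_tendsto' hlim hlow)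
  · have := ciInf_le hb n
    rwa [le_div_iff₀ (by positivity), mul_comm] at this

end Iteration

/-! ### Convergence of the Koenigs series at `T` -/

section Convergence

variable {r x T : ℝ}

theorem iterate_expStep_le_koenigsPartial (h0 : 0 < r) (h1 : r < 1) (N : ℕ) (hT : 0 ≤ T)
    (n : ℕ) : (expStep r)^[n] (koenigsPartial r N T) ≤ koenigsPartial r N (r ^ n * T) := by
  induction n with
  | zero => simp
  | succ n ih =>
    rw [Function.iterate_succ_apply', pow_succ', mul_assoc]
    exact (expStep_mono h0 ih).trans
      (one_sub_exp_le_koenigsPartial h0 h1 N (by positivity))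

theorem tendsto_div_pow_of_hasDerivAt_one {f : ℝ → ℝ} (hf : HasDerivAt f 1 0) (hf0 : f 0 = 0)
    (h0 : 0 < r) (h1 : r < 1) (hT : 0 < T) :
    Tendsto (fun n : ℕ => f (r ^ n * T) / r ^ n) atTop (𝓝 T) := by
  have h := hf.tendsto_slope
  have hu : Tendsto (fun n : ℕ => r ^ n * T) atTop (𝓝[≠] 0) := by
    refine tendsto_nhdsWithin_iff.2 ⟨?_, Eventually.of_forall fun n => ?_⟩
    · simpa using (tendsto_pow_atTop_nhds_zero_of_lt_one h0.le h1).mul_const T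
    · exact (mul_pos (pow_pos h0 n) hT).ne'
  have h2 := (h.comp hu).mul_const T
  rw [one_mul] at h2
  refine h2.congr fun n => ?_
  have : r ^ n ≠ 0 := (pow_pos h0 n).ne'
  simp only [Function.comp, slope_def_field, hf0, sub_zero]
  field_simp

/-- The index `N + 1` ensures that the linear term is present, so that the derivative at `0` is `1`.
-/
theorem koenigsPartial_le (h0 : 0 < r) (h1 : r < 1) (hx : 0 ≤ x) (hT : 0 < T)
    (hle : ∀ n, r ^ n * T ≤ (expStep r)^[n] x) (N : ℕ) :
    koenigsPartial r (N + 1) T ≤ x := by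
  by_contra! hlt
  set y := koenigsPartial r (N + 1) T with hy
  set c := (y - x) * Real.exp (-(y / (1 - r))) with hc
  have hcpos : 0 < c := mul_pos (by linarith) (Real.exp_pos _)
  have hd : HasDerivAt (koenigsPartial r (N + 1)) 1 0 := by
    have := hasDerivAt_koenigsPartial (r := r) (N + 1) 0
    rw [Finset.sum_range_succ'] at this
    simpa [koenigsCoeff_one] using this
  have hlim := tendsto_div_pow_of_hasDerivAt_one hd (koenigsPartial_zero _) h0 h1 hT
  -- After division by `r ^ n`, the orbit of `y` is at least `T + c` but is bounded by
  -- `koenigsPartial r (N + 1) (r ^ n * T) / r ^ n`, which tends to `T`.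
  have : T + c ≤ T := by
    refine ge_of_tendsto' hlim fun n => ?_
    rw [le_div_iff₀ (by positivity)]
    have e1 := iterate_expStep_le_koenigsPartial h0 h1 (N + 1) hT.le n
    have e2 := le_iterate_expStep_sub h0 h1 (hx.trans hlt.le) hlt.le n
    have e3 := hle n
    linarith
  linarith

theorem summable_koenigsCoeff (h0 : 0 < r) (h1 : r < 1) (hx : 0 ≤ x) (hT : 0 < T)
    (hle : ∀ n, r ^ n * T ≤ (expStep r)^[n] x) :
    Summable fun k => koenigsCoeff r k * T ^ k := by
  refine summable_of_sum_range_le (c := x)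
    (fun k => mul_nonneg (koenigsCoeff_nonneg h0 h1 k) (by positivity)) fun n => ?_
  refine le_trans ?_ (koenigsPartial_le h0 h1 hx hT hle n)
  exact Finset.sum_le_sum_of_subset_of_nonneg (range_subset_range.2 (by omega))
    fun k _ _ => mul_nonneg (koenigsCoeff_nonneg h0 h1 k) (by positivity)

theorem tsum_koenigsCoeff_le (h0 : 0 < r) (h1 : r < 1) (hx : 0 ≤ x) (hT : 0 < T)
    (hle : ∀ n, r ^ n * T ≤ (expStep r)^[n] x) :
    ∑' k, koenigsCoeff r k * T ^ k ≤ x := by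
  refine Real.tsum_le_of_sum_range_le
    (fun k => mul_nonneg (koenigsCoeff_nonneg h0 h1 k) (by positivity)) fun n => ?_
  refine le_trans ?_ (koenigsPartial_le h0 h1 hx hT hle n)
  exact Finset.sum_le_sum_of_subset_of_nonneg (range_subset_range.2 (by omega))
    fun k _ _ => mul_nonneg (koenigsCoeff_nonneg h0 h1 k) (by positivity)

end Convergence

/-! ### The Koenigs function on the closed disc of radius `T` -/

section KoenigsFunction

/-- The power series with coefficients `koenigsCoeff r`. -/
noncomputable def koenigsFun (r : ℝ) (t : ℂ) : ℂ := ∑' k, (koenigsCoeff r k : ℂ) * t ^ k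

variable {r T : ℝ}

theorem norm_koenigsCoeff_mul_pow_le (h0 : 0 < r) (h1 : r < 1) {t : ℂ} (ht : ‖t‖ ≤ T) (k : ℕ) :
    ‖(koenigsCoeff r k : ℂ) * t ^ k‖ ≤ koenigsCoeff r k * T ^ k := by
  have := koenigsCoeff_nonneg h0 h1 k
  rw [norm_mul, norm_pow, Complex.norm_real, Real.norm_of_nonneg this]
  gcongr

theorem koenigsFun_zero : koenigsFun r 0 = 0 := by
  rw [koenigsFun, tsum_eq_single 0 fun k hk => by simp [hk]]
  simp [koenigsCoeff_zero]

theorem continuousOn_koenigsFun (h0 : 0 < r) (h1 : r < 1)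
    (hs : Summable fun k => koenigsCoeff r k * T ^ k) :
    ContinuousOn (koenigsFun r) (Metric.closedBall 0 T) :=
  continuousOn_tsum (fun k => by fun_prop) hs fun k _ ht =>
    norm_koenigsCoeff_mul_pow_le h0 h1 (mem_closedBall_zero_iff.1 ht) k

theorem differentiableOn_koenigsFun (h0 : 0 < r) (h1 : r < 1)
    (hs : Summable fun k => koenigsCoeff r k * T ^ k) :
    DifferentiableOn ℂ (koenigsFun r) (Metric.ball 0 T) :=
  Complex.differentiableOn_tsum_of_summable_norm hs (fun k => by fun_prop) Metric.isOpen_ball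
    fun k _ ht => norm_koenigsCoeff_mul_pow_le h0 h1 (mem_ball_zero_iff.1 ht).le k

theorem hasSum_deriv_koenigsFun (h0 : 0 < r) (h1 : r < 1)
    (hs : Summable fun k => koenigsCoeff r k * T ^ k) {t : ℂ} (ht : ‖t‖ < T) :
    HasSum (fun k : ℕ => ((k + 1 : ℝ) * koenigsCoeff r (k + 1) : ℂ) * t ^ k)
      (deriv (koenigsFun r) t) := by
  have h := Complex.hasSum_deriv_of_summable_norm (F := fun k t => (koenigsCoeff r k : ℂ) * t ^ k)
    hs (fun k => by fun_prop) Metric.isOpen_ball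
    (fun k _ ht => norm_koenigsCoeff_mul_pow_le h0 h1 (mem_ball_zero_iff.1 ht).le k)
    (mem_ball_zero_iff.2 ht)
  have h2 := (hasSum_nat_add_iff' 1).2 h
  convert! h2 using 1
  · funext k
    simp
    ring
  · simp
    rfl

theorem deriv_koenigsFun_eq (h0 : 0 < r) (h1 : r < 1)
    (hs : Summable fun k => koenigsCoeff r k * T ^ k) {t : ℂ} (ht : ‖t‖ < T) :
    deriv (koenigsFun r) t =
      deriv (koenigsFun r) (r * t) + deriv (koenigsFun r) t * koenigsFun r (r * t) := by
  have hrt : ‖(r : ℂ) * t‖ ≤ ‖t‖ := by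
    rw [norm_mul, Complex.norm_real, Real.norm_of_nonneg h0.le]
    exact mul_le_of_le_one_left (norm_nonneg _) h1.le
  have hd := hasSum_deriv_koenigsFun h0 h1 hs ht
  have hd' := hasSum_deriv_koenigsFun h0 h1 hs (hrt.trans_lt ht)
  have hH : Summable fun k => ‖(koenigsCoeff r k : ℂ) * (r * t) ^ k‖ :=
    hs.of_nonneg_of_le (fun _ => norm_nonneg _)
      (norm_koenigsCoeff_mul_pow_le h0 h1 (hrt.trans ht.le))
  have hprod := tsum_mul_tsum_eq_tsum_sum_antidiagonal_of_summable_norm hd.summable.norm hH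
  have hsum := (summable_norm_sum_mul_antidiagonal_of_summable_norm hd.summable.norm hH).of_norm
  conv_rhs => rw [← hd.tsum_eq, ← hd'.tsum_eq, koenigsFun, hprod, ← hd'.summable.tsum_add hsum]
  rw [← hd.tsum_eq]
  refine tsum_congr fun k => ?_
  have hk := congrArg (fun x : ℝ => (x : ℂ)) (koenigsCoeff_rec h0 h1 k)
  push_cast at hk ⊢
  conv_lhs => rw [hk]
  rw [add_mul, Finset.sum_mul]
  congr 1
  · rw [mul_pow]; ring
  · refine Finset.sum_congr rfl fun p hp => ?_
    rw [← HasAntidiagonal.mem_antidiagonal.1 hp, mul_pow, pow_add]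
    ring

/-- The Schröder equation. -/
theorem koenigsFun_mul (h0 : 0 < r) (h1 : r < 1)
    (hs : Summable fun k => koenigsCoeff r k * T ^ k) {t : ℂ} (ht : ‖t‖ < T) :
    koenigsFun r (r * t) = 1 - Complex.exp (-(r * koenigsFun r t)) := by
  set φ : ℂ → ℂ := fun t =>
    (1 - koenigsFun r (r * t)) * Complex.exp (r * koenigsFun r t) with hφ
  have hdiff : ∀ t : ℂ, ‖t‖ < T → HasDerivAt (koenigsFun r) (deriv (koenigsFun r) t) t :=
    fun t ht => ((differentiableOn_koenigsFun h0 h1 hs).differentiableAt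
      (Metric.isOpen_ball.mem_nhds (mem_ball_zero_iff.2 ht))).hasDerivAt
  have hd : ∀ t : ℂ, ‖t‖ < T → HasDerivAt φ 0 t := fun t ht => by
    have hrt : ‖(r : ℂ) * t‖ ≤ ‖t‖ := by
      rw [norm_mul, Complex.norm_real, Real.norm_of_nonneg h0.le]
      exact mul_le_of_le_one_left (norm_nonneg _) h1.le
    have h := ((((hdiff _ (hrt.trans_lt ht)).comp t
      ((hasDerivAt_id t).const_mul (r : ℂ)))).const_sub 1).mul
      (((hdiff t ht).const_mul (r : ℂ)).cexp)
    convert! h using 1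
    have := deriv_koenigsFun_eq h0 h1 hs ht
    simp only [Function.comp]
    linear_combination (- (r : ℂ) * Complex.exp (r * koenigsFun r t)) * this
  have hT : 0 < T := (norm_nonneg t).trans_lt ht
  -- The derivative of `φ` vanishes by `deriv_koenigsFun_eq`, and `φ 0 = 1`.
  have hc : φ t = φ 0 := by
    refine Metric.isOpen_ball.is_const_of_deriv_eq_zero (s := Metric.ball (0 : ℂ) T)
      (convex_ball _ _).isPreconnected
      (fun t ht => (hd t (mem_ball_zero_iff.1 ht)).differentiableAt.differentiableWithinAt)
      (fun t ht => (hd t (mem_ball_zero_iff.1 ht)).deriv) (mem_ball_zero_iff.2 ht)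
      (Metric.mem_ball_self hT)
  simp only [hφ, mul_zero, koenigsFun_zero, sub_zero, Complex.exp_zero, mul_one] at hc
  rw [Complex.exp_neg, ← eq_div_of_mul_eq (Complex.exp_ne_zero _) hc |>.trans (one_div _)]
  ring

theorem koenigsFun_ofReal (t : ℝ) :
    koenigsFun r t = ((∑' k, koenigsCoeff r k * t ^ k : ℝ) : ℂ) := by
  rw [koenigsFun, Complex.ofReal_tsum]
  push_cast
  rfl

/-- The derivative argument covers only the open disc; absolute convergence at `T` gives continuity
up to the boundary, where the orbit starts. -/
theorem koenigsFun_mul_boundary (h0 : 0 < r) (h1 : r < 1) (hT : 0 < T)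
    (hs : Summable fun k => koenigsCoeff r k * T ^ k) :
    koenigsFun r (r * T) = 1 - Complex.exp (-(r * koenigsFun r T)) := by
  have hcont := continuousOn_koenigsFun h0 h1 hs
  have hmem : (T : ℂ) ∈ closure (Metric.ball (0 : ℂ) T) := by
    rw [closure_ball _ hT.ne', mem_closedBall_zero_iff, Complex.norm_real,
      Real.norm_of_nonneg hT.le]
  have hsub : Metric.closedBall (0 : ℂ) T = closure (Metric.ball (0 : ℂ) T) :=
    (closure_ball _ hT.ne').symm
  have hr : Set.MapsTo (fun t : ℂ => (r : ℂ) * t) (Metric.closedBall 0 T)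
      (Metric.closedBall 0 T) := fun t ht => by
    rw [mem_closedBall_zero_iff] at ht ⊢
    rw [norm_mul, Complex.norm_real, Real.norm_of_nonneg h0.le]
    exact (mul_le_of_le_one_left (norm_nonneg _) h1.le).trans ht
  have heq : Set.EqOn (fun t : ℂ => koenigsFun r (r * t))
      (fun t => 1 - Complex.exp (-(r * koenigsFun r t))) (Metric.ball 0 T) :=
    fun t ht => koenigsFun_mul h0 h1 hs (mem_ball_zero_iff.1 ht)
  refine heq.of_subset_closure (hcont.comp (by fun_prop) hr) ?_ Metric.ball_subset_closedBall
    hsub.le (hsub ▸ hmem)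
  exact continuousOn_const.sub ((continuousOn_const.mul hcont).neg.cexp)

variable {x : ℝ}

/-- At the limit of the rescaled iterates of `x`, the power series takes the value `x`, and its
values at `r ^ n * T` are the iterates. -/
theorem koenigsFun_pow_mul (h0 : 0 < r) (h1 : r < 1) (hx : 0 ≤ x) (hT : 0 < T)
    (hlim : Tendsto (fun n => (expStep r)^[n] x / r ^ n) atTop (𝓝 T))
    (hle : ∀ n, r ^ n * T ≤ (expStep r)^[n] x) (n : ℕ) :
    koenigsFun r ((r : ℂ) ^ n * T) = (((expStep r)^[n] x : ℝ) : ℂ) := by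
  have hs := summable_koenigsCoeff h0 h1 hx hT hle
  set y := ∑' k, koenigsCoeff r k * T ^ k with hy
  have hyx : y ≤ x := tsum_koenigsCoeff_le h0 h1 hx hT hle
  have hiter : ∀ n, koenigsFun r ((r : ℂ) ^ n * T) = (((expStep r)^[n] y : ℝ) : ℂ) := by
    intro n
    induction n with
    | zero => simp [koenigsFun_ofReal, hy]
    | succ n ih =>
      have hstep : koenigsFun r (r * ((r : ℂ) ^ n * T)) =
          1 - Complex.exp (-(r * koenigsFun r ((r : ℂ) ^ n * T))) := by
        rcases Nat.eq_zero_or_pos n with rfl | hn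
        · simpa using koenigsFun_mul_boundary h0 h1 hT hs
        · refine koenigsFun_mul h0 h1 hs ?_
          rw [norm_mul, norm_pow, Complex.norm_real, Complex.norm_real,
            Real.norm_of_nonneg h0.le, Real.norm_of_nonneg hT.le]
          exact mul_lt_of_lt_one_left hT (pow_lt_one₀ h0.le h1 hn.ne')
      rw [pow_succ', mul_assoc, hstep, ih, Function.iterate_succ_apply', expStep]
      push_cast
      rfl
  -- All terms are nonnegative, so the sum dominates its linear term.
  have hlow : ∀ n : ℕ, r ^ n * T ≤ (expStep r)^[n] y := by
    intro n
    have hnn : 0 ≤ r ^ n * T := by positivity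
    have hle' : r ^ n * T ≤ T := mul_le_of_le_one_left hT.le (pow_le_one₀ h0.le h1.le)
    have h := hiter n
    rw [← Complex.ofReal_pow, ← Complex.ofReal_mul, koenigsFun_ofReal, Complex.ofReal_inj] at h
    rw [← h]
    have hs' : Summable fun k => koenigsCoeff r k * (r ^ n * T) ^ k :=
      hs.of_nonneg_of_le (fun k => mul_nonneg (koenigsCoeff_nonneg h0 h1 k) (by positivity))
        fun k => mul_le_mul_of_nonneg_left (pow_le_pow_left₀ hnn hle' k)
          (koenigsCoeff_nonneg h0 h1 k)
    simpa [koenigsCoeff_one] using hs'.le_tsum 1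
      fun k _ => mul_nonneg (koenigsCoeff_nonneg h0 h1 k) (by positivity)
  -- If `y < x`, the orbit of `x` would exceed that of `y` by a fixed multiple of `r ^ n`, pushing
  -- its rescaled limit above `T`.
  have hxy : y = x := by
    by_contra hne
    have hlt : y < x := lt_of_le_of_ne hyx hne
    have hc : 0 < (x - y) * Real.exp (-(x / (1 - r))) :=
      mul_pos (by linarith) (Real.exp_pos _)
    have : T + (x - y) * Real.exp (-(x / (1 - r))) ≤ T := by
      refine ge_of_tendsto' hlim fun n => ?_
      rw [le_div_iff₀ (by positivity)]
      have e2 := le_iterate_expStep_sub h0 h1 hx hyx n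
      have e3 := hlow n
      linarith
    linarith
  rw [hiter, hxy]

end KoenigsFunction

/-! ### The Gamma integral split at `1` and continued analytically -/

section SplitGamma

theorem integrableOn_cpow_mul_exp_neg_mul_Ioi_one (s : ℂ) {μ : ℝ} (hμ : 0 < μ) :
    IntegrableOn (fun w : ℝ => (w : ℂ) ^ (s - 1) * Complex.exp (-(μ * w))) (Set.Ioi 1) := by
  -- The exponent `|s.re|` dominates `s.re - 1` on `w > 1` and exceeds `-1`, so the majorant is
  -- integrable on all of `(0, ∞)`.
  have hI : IntegrableOn (fun w : ℝ => w ^ |s.re| * Real.exp (-μ * w ^ (1 : ℝ))) (Set.Ioi 1) :=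
    (integrableOn_rpow_mul_exp_neg_mul_rpow (by linarith [abs_nonneg s.re]) one_pos
      hμ).mono_set (Set.Ioi_subset_Ioi zero_le_one)
  refine hI.mono' ?_ ?_
  · refine ContinuousOn.aestronglyMeasurable (fun w hw => ?_) measurableSet_Ioi
    have : (0 : ℝ) < w := one_pos.trans hw
    exact ((Complex.continuousAt_ofReal_cpow_const w _ (Or.inr this.ne')).mul
      (by fun_prop)).continuousWithinAt
  · refine (ae_restrict_iff' measurableSet_Ioi).2 (Eventually.of_forall fun w hw => ?_)
    have h1 : (1 : ℝ) < w := hw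
    rw [norm_mul, Complex.norm_cpow_eq_rpow_re_of_pos (one_pos.trans h1), Complex.norm_exp,
      Real.rpow_one]
    have h2 : w ^ (s - 1).re ≤ w ^ |s.re| :=
      Real.rpow_le_rpow_of_exponent_le h1.le (by simp; linarith [le_abs_self s.re])
    have h3 : (-(μ * (w : ℂ))).re = -μ * w := by simp
    rw [h3]
    gcongr

theorem summable_one_div_factorial_mul_norm_add (s : ℂ) :
    Summable fun n : ℕ => 1 / ((n.factorial : ℝ) * ‖(n : ℂ) + s‖) := by
  have h : Summable fun n : ℕ => (1 : ℝ) / n.factorial := by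
    simpa using Real.summable_pow_div_factorial 1
  refine Summable.of_norm_bounded_eventually_nat h ?_
  filter_upwards [eventually_ge_atTop (⌈‖s‖⌉₊ + 1)] with n hn
  have h1 : ‖s‖ + 1 ≤ n := by
    have := Nat.le_ceil ‖s‖
    have h2 : ((⌈‖s‖⌉₊ + 1 : ℕ) : ℝ) ≤ n := by exact_mod_cast hn
    push_cast at h2
    linarith
  have h2 : 1 ≤ ‖(n : ℂ) + s‖ := by
    have := norm_sub_le ((n : ℂ) + s) s
    rw [add_sub_cancel_right, Complex.norm_natCast] at this
    linarith
  rw [Real.norm_of_nonneg (by positivity)]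
  exact one_div_le_one_div_of_le (by positivity) (le_mul_of_one_le_right (by positivity) h2)

theorem summable_neg_pow_div (s : ℂ) {μ : ℝ} (hμ : 0 < μ) (hμ1 : μ ≤ 1) :
    Summable fun n : ℕ => (-(μ : ℂ)) ^ n / ((n.factorial : ℂ) * (n + s)) := by
  refine (summable_one_div_factorial_mul_norm_add s).of_norm_bounded fun n => ?_
  rw [norm_div, norm_pow, norm_neg, Complex.norm_real, Real.norm_of_nonneg hμ.le, norm_mul,
    Complex.norm_natCast]
  exact div_le_div_of_nonneg_right (pow_le_one₀ hμ.le hμ1) (by positivity)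

theorem integral_Ioc_cpow_mul_exp_neg_mul {s : ℂ} (hs : 0 < s.re) {μ : ℝ} (hμ : 0 < μ)
    (hμ1 : μ ≤ 1) :
    ∑' n : ℕ, (-(μ : ℂ)) ^ n / ((n.factorial : ℂ) * (n + s)) =
      ∫ w in Set.Ioc (0 : ℝ) 1, (w : ℂ) ^ (s - 1) * Complex.exp (-(μ * w)) := by
  have hs' : ∀ n : ℕ, s ≠ -n := fun n h => by
    rw [h] at hs
    simp at hs
    linarith [(Nat.cast_nonneg n : (0 : ℝ) ≤ n)]
  set F : ℕ → ℝ → ℂ := fun n w => (-(μ : ℂ)) ^ n / n.factorial * (w : ℂ) ^ (n + s - 1) with hF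
  have hre : ∀ n : ℕ, -1 < ((n : ℂ) + s - 1).re := fun n => by
    have : (0 : ℝ) ≤ n := Nat.cast_nonneg n
    simp; linarith
  have hint : ∀ n, IntegrableOn (F n) (Set.Ioc 0 1) := fun n =>
    ((intervalIntegrable_iff_integrableOn_Ioc_of_le zero_le_one).1
      (intervalIntegral.intervalIntegrable_cpow' (hre n))).const_mul _
  have hval : ∀ n, ∫ w in Set.Ioc (0 : ℝ) 1, F n w =
      (-(μ : ℂ)) ^ n / ((n.factorial : ℂ) * (n + s)) := fun n => by
    have hne : (n : ℂ) + s ≠ 0 := fun h => hs' n (eq_neg_of_add_eq_zero_right h)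
    rw [hF]
    simp only
    rw [integral_const_mul, ← intervalIntegral.integral_of_le zero_le_one,
      integral_cpow (Or.inl (hre n))]
    simp [hne, div_eq_mul_inv]
    ring
  have hnorm : ∀ n, ∫ w in Set.Ioc (0 : ℝ) 1, ‖F n w‖ ≤ 1 / n.factorial * (1 / s.re) := fun n => by
    have hpow : IntegrableOn (fun w : ℝ => w ^ (s.re - 1)) (Set.Ioc 0 1) :=
      (intervalIntegrable_iff_integrableOn_Ioc_of_le zero_le_one).1
        (intervalIntegral.intervalIntegrable_rpow' (by linarith))
    have hv : ∫ w in Set.Ioc (0 : ℝ) 1, w ^ (s.re - 1) = 1 / s.re := by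
      rw [← intervalIntegral.integral_of_le zero_le_one, integral_rpow (Or.inl (by linarith))]
      simp [hs.ne']
    rw [← hv, ← integral_const_mul]
    refine setIntegral_mono_on (hint n).norm (hpow.const_mul _) measurableSet_Ioc fun w hw => ?_
    simp only [hF]
    rw [norm_mul, Complex.norm_cpow_eq_rpow_re_of_pos hw.1, norm_div, norm_pow, norm_neg,
      Complex.norm_real, Real.norm_of_nonneg hμ.le, Complex.norm_natCast]
    have h1 : w ^ ((n : ℂ) + s - 1).re ≤ w ^ (s.re - 1) :=
      Real.rpow_le_rpow_of_exponent_ge hw.1 hw.2 (by simp)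
    have h2 : μ ^ n ≤ 1 := pow_le_one₀ hμ.le hμ1
    have h3 : 0 ≤ w ^ ((n : ℂ) + s - 1).re := Real.rpow_nonneg hw.1.le _
    gcongr
  have hsum : Summable fun n => ∫ w in Set.Ioc (0 : ℝ) 1, ‖F n w‖ := by
    refine Summable.of_nonneg_of_le (fun n => integral_nonneg fun w => norm_nonneg _) hnorm ?_
    refine Summable.mul_right _ ?_
    simpa using Real.summable_pow_div_factorial 1
  have h := hasSum_integral_of_summable_integral_norm hint hsum
  simp only [hval] at h
  rw [h.tsum_eq]
  refine setIntegral_congr_fun measurableSet_Ioc fun w hw => ?_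
  have hw0 : (w : ℂ) ≠ 0 := by exact_mod_cast hw.1.ne'
  simp only [hF]
  have : ∀ n : ℕ, (-(μ : ℂ)) ^ n / n.factorial * (w : ℂ) ^ ((n : ℂ) + s - 1) =
      (w : ℂ) ^ (s - 1) * ((-(μ * w) : ℂ) ^ n / n.factorial) := fun n => by
    rw [add_sub_assoc, Complex.cpow_add _ _ hw0, Complex.cpow_natCast, ← neg_mul, mul_pow]
    ring
  simp only [this]
  rw [tsum_mul_left, Complex.exp_eq_exp_ℂ, NormedSpace.exp_eq_tsum_div]

theorem integral_Ioi_one_add_one {s : ℂ} {μ : ℝ} (hμ : 0 < μ) :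
    μ * ∫ w in Set.Ioi (1 : ℝ), (w : ℂ) ^ (s + 1 - 1) * Complex.exp (-(μ * w)) =
      s * (∫ w in Set.Ioi (1 : ℝ), (w : ℂ) ^ (s - 1) * Complex.exp (-(μ * w))) +
        Complex.exp (-μ) := by
  have hi := (integrableOn_cpow_mul_exp_neg_mul_Ioi_one s hμ).const_mul s
  have hi' := (integrableOn_cpow_mul_exp_neg_mul_Ioi_one (s + 1) hμ).const_mul (μ : ℂ)
  have hlim : Tendsto (fun w : ℝ => (w : ℂ) ^ s * Complex.exp (-(μ * w))) atTop (𝓝 0) := by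
    rw [tendsto_zero_iff_norm_tendsto_zero]
    refine (tendsto_rpow_mul_exp_neg_mul_atTop_nhds_zero s.re μ hμ).congr' ?_
    filter_upwards [eventually_gt_atTop 0] with w hw
    rw [norm_mul, Complex.norm_cpow_eq_rpow_re_of_pos hw, Complex.norm_exp]
    simp
  have h := integral_Ioi_of_hasDerivAt_of_tendsto' (a := (1 : ℝ)) (fun w hw => ?_)
    (hi.sub hi') hlim
  · rw [integral_sub' hi hi', integral_const_mul, integral_const_mul] at h
    simp at h ⊢
    linear_combination -h
  · have hw0 : (0 : ℝ) < w := one_pos.trans_le hw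
    have e1 : HasDerivAt (fun w : ℝ => (w : ℂ) ^ s) (s * (w : ℂ) ^ (s - 1)) w := by
      have := (hasDerivAt_id (w : ℂ)).cpow_const (c := s) (Or.inl (by simpa using hw0))
      simpa using this.comp_ofReal
    have e2 : HasDerivAt (fun w : ℝ => Complex.exp (-(μ * w)))
        (Complex.exp (-(μ * w)) * -(μ * 1)) w :=
      ((Complex.ofRealCLM.hasDerivAt.const_mul (μ : ℂ)).neg).cexp
    convert! e1.mul e2 using 1
    simp
    ring

theorem tsum_neg_pow_div_add_one {s : ℂ} (hs : ∀ n : ℕ, s ≠ -n) {μ : ℝ} (hμ : 0 < μ)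
    (hμ1 : μ ≤ 1) :
    μ * ∑' n : ℕ, (-(μ : ℂ)) ^ n / ((n.factorial : ℂ) * (n + (s + 1))) =
      s * (∑' n : ℕ, (-(μ : ℂ)) ^ n / ((n.factorial : ℂ) * (n + s))) - Complex.exp (-μ) := by
  have hsum := (summable_neg_pow_div s hμ hμ1).mul_left s
  have hexp : HasSum (fun n : ℕ => (-(μ : ℂ)) ^ n / n.factorial) (Complex.exp (-μ)) := by
    rw [Complex.exp_eq_exp_ℂ]
    exact NormedSpace.expSeries_div_hasSum_exp _
  have hd := hsum.hasSum.sub hexp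
  rw [tsum_mul_left] at hd
  have h0 : s ≠ 0 := by simpa using hs 0
  -- The term `n = 0` is `s / s - 1 = 0`, so the sum may be shifted by one.
  have hd1 := (hasSum_nat_add_iff' 1).2 hd
  rw [Finset.sum_range_one, Nat.factorial_zero, pow_zero, Nat.cast_zero, zero_add, Nat.cast_one,
    one_mul, mul_one_div_cancel h0, div_one, sub_self, sub_zero] at hd1
  rw [← tsum_mul_left, ← hd1.tsum_eq]
  refine tsum_congr fun n => ?_
  have hne : (n : ℂ) + 1 + s ≠ 0 := fun h => hs (n + 1) (by
    push_cast; exact eq_neg_of_add_eq_zero_right h)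
  have hne' : (n : ℂ) + (s + 1) ≠ 0 := by rwa [add_comm s, ← add_assoc]
  have hf : (n.factorial : ℂ) ≠ 0 := by exact_mod_cast n.factorial_ne_zero
  have hn1 : (n : ℂ) + 1 ≠ 0 := by exact_mod_cast n.succ_ne_zero
  rw [Nat.factorial_succ, pow_succ]
  push_cast
  field_simp
  ring

/-- The splitting of the integral representing `Γ(s) μ⁻ˢ` at `1`, continued analytically to all
`s` that are not poles of the Gamma function. -/
theorem tsum_add_integral_Ioi_one_eq_Gamma {s : ℂ} (hs : ∀ n : ℕ, s ≠ -n) {μ : ℝ} (hμ : 0 < μ)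
    (hμ1 : μ ≤ 1) :
    ∑' n : ℕ, (-(μ : ℂ)) ^ n / ((n.factorial : ℂ) * (n + s)) +
      ∫ w in Set.Ioi (1 : ℝ), (w : ℂ) ^ (s - 1) * Complex.exp (-(μ * w)) =
      Complex.Gamma s * (μ : ℂ) ^ (-s) := by
  have hμ0 : (μ : ℂ) ≠ 0 := by exact_mod_cast hμ.ne'
  obtain ⟨m, hm⟩ : ∃ m : ℕ, 0 < s.re + m := by
    obtain ⟨m, hm⟩ := exists_nat_gt (-s.re)
    exact ⟨m, by linarith⟩
  -- Both sides satisfy `μ * f (s + 1) = s * f s`: on the left, the boundary terms `exp (-μ)` of the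
  -- series and the integral cancel. Each step moves the claim one unit to the left.
  induction m generalizing s with
  | zero =>
    have hre : 0 < s.re := by simpa using hm
    have hG := Complex.integral_cpow_mul_exp_neg_mul_Ioi (a := s) (r := μ) hre hμ
    have hinv : (1 / (μ : ℂ)) ^ s = (μ : ℂ) ^ (-s) := by
      rw [one_div, Complex.inv_cpow _ _ (by
        rw [Complex.arg_ofReal_of_nonneg hμ.le]; exact Real.pi_pos.ne), Complex.cpow_neg]
    have hint : IntegrableOn (fun w : ℝ => (w : ℂ) ^ (s - 1) * Complex.exp (-(μ * w)))
        (Set.Ioi 0) := by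
      -- A non-integrable function would have integral `0` by convention, while the Gamma value is
      -- nonzero.
      refine Integrable.of_integral_ne_zero ?_
      rw [hG, hinv]
      exact mul_ne_zero (by simp [Complex.cpow_eq_zero_iff, hμ0]) (Complex.Gamma_ne_zero hs)
    rw [integral_Ioc_cpow_mul_exp_neg_mul hre hμ hμ1, ← setIntegral_union
      (Set.Ioc_disjoint_Ioi le_rfl) measurableSet_Ioi (hint.mono_set Set.Ioc_subset_Ioi_self)
      (hint.mono_set (Set.Ioi_subset_Ioi zero_le_one)),
      Set.Ioc_union_Ioi_eq_Ioi zero_le_one, hG, hinv, mul_comm]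
  | succ m ih =>
    have hs1 : ∀ n : ℕ, s + 1 ≠ -n := fun n h => hs (n + 1) (by
      push_cast; linear_combination h)
    have h0 : s ≠ 0 := by simpa using hs 0
    have h := ih hs1 (by simp at hm ⊢; linarith)
    have e1 := tsum_neg_pow_div_add_one hs hμ hμ1
    have e2 := integral_Ioi_one_add_one (s := s) hμ
    rw [Complex.Gamma_add_one _ h0, neg_add, Complex.cpow_add _ _ hμ0, Complex.cpow_neg_one] at h
    apply mul_left_cancel₀ h0
    have h3 : (μ : ℂ) * (s * Complex.Gamma s * ((μ : ℂ) ^ (-s) * (μ : ℂ)⁻¹)) =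
      s * (Complex.Gamma s * (μ : ℂ) ^ (-s)) := by field_simp
    rw [← h3, ← h]
    linear_combination -e1 - e2

end SplitGamma

/-! ### Summing the formula over the exponentials `r ^ (k n)` -/

section Series

variable {α r : ℝ} {b : ℕ → ℂ}

theorem tsum_tsum_mul_pow_mul {c : ℕ → ℂ} (hc : Summable fun k => ‖c k‖) {μ : ℕ → ℝ}
    (hμ0 : ∀ k, 0 ≤ μ k) (hμ1 : ∀ k, μ k ≤ 1) {g : ℕ → ℂ} (hg : Summable fun n => ‖g n‖) :
    ∑' n, (∑' k, c k * (μ k : ℂ) ^ n) * g n = ∑' k, c k * ∑' n, (μ k : ℂ) ^ n * g n := by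
  have hs : Summable (Function.uncurry fun n k => c k * (μ k : ℂ) ^ n * g n) := by
    refine (hg.mul_of_nonneg hc (fun _ => norm_nonneg _) fun _ => norm_nonneg _).of_norm_bounded
      fun p => ?_
    simp only [Function.uncurry]
    rw [norm_mul, norm_mul, norm_pow, Complex.norm_real, Real.norm_of_nonneg (hμ0 _), mul_comm]
    gcongr
    exact mul_le_of_le_one_right (norm_nonneg _) (pow_le_one₀ (hμ0 _) (hμ1 _))
  simp only [← tsum_mul_right, ← tsum_mul_left, ← mul_assoc]
  exact hs.tsum_comm.symm

theorem ofReal_pow_cpow (h0 : 0 ≤ r) (k : ℕ) (z : ℂ) :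
    ((r ^ k : ℝ) : ℂ) ^ z = ((r : ℂ) ^ z) ^ k := by
  induction k with
  | zero => simp
  | succ k ih =>
    rw [pow_succ, pow_succ, Complex.ofReal_mul,
      Complex.mul_cpow_ofReal_nonneg (by positivity) h0, ih]

theorem summable_norm_mul_pow (h0 : 0 < r) (h1 : r < 1) (hb : Summable fun k => ‖b k‖) :
    Summable fun k => ‖b k * ((r ^ k : ℝ) : ℂ)‖ :=
  hb.of_nonneg_of_le (fun _ => norm_nonneg _) fun k => by
    rw [norm_mul, Complex.norm_real, Real.norm_of_nonneg (by positivity)]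
    exact mul_le_of_le_one_right (norm_nonneg _) (pow_le_one₀ h0.le h1.le)

theorem norm_natTower_le (h0 : 0 < r) (h1 : r < 1) (hb : Summable fun k => ‖b k‖)
    (ha : ∀ n, (natTower α (n + 1) : ℂ) =
      ∑' k, b k * ((r ^ k : ℝ) : ℂ) * ((r ^ k : ℝ) : ℂ) ^ n) (n : ℕ) :
    ‖(natTower α (n + 1) : ℂ)‖ ≤ ∑' k, ‖b k‖ := by
  rw [ha]
  refine tsum_of_norm_bounded hb.hasSum fun k => ?_
  have h2 : r ^ k ≤ 1 := pow_le_one₀ h0.le h1.le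
  have h3 : 0 ≤ r ^ k := by positivity
  rw [norm_mul, norm_mul, norm_pow, Complex.norm_real, Real.norm_of_nonneg h3, mul_assoc]
  exact mul_le_of_le_one_right (norm_nonneg _)
    (mul_le_one₀ h2 (by positivity) (pow_le_one₀ h3 h2))

theorem summable_auxTerm {B : ℝ} (hB : ∀ n, ‖(natTower α (n + 1) : ℂ)‖ ≤ B) (w : ℂ) :
    Summable (auxTerm α w) := by
  refine ((Real.summable_pow_div_factorial ‖w‖).mul_left B).of_norm_bounded fun n => ?_
  rw [auxTerm, norm_mul, norm_div, norm_pow, norm_neg, Complex.norm_natCast]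
  exact mul_le_mul_of_nonneg_right (hB n) (by positivity)

theorem summable_norm_poleTerm_coeff (z : ℂ) :
    Summable fun n : ℕ => ‖(-1 : ℂ) ^ n / ((n.factorial : ℂ) * ((n : ℂ) + 1 - z))‖ := by
  refine (summable_one_div_factorial_mul_norm_add (1 - z)).congr fun n => ?_
  rw [norm_div, norm_pow, norm_neg, norm_one, one_pow, norm_mul, Complex.norm_natCast,
    add_sub_assoc]

theorem summable_poleTerm {B : ℝ} (hB : ∀ n, ‖(natTower α (n + 1) : ℂ)‖ ≤ B) (z : ℂ) :
    Summable (poleTerm α z) := by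
  refine ((summable_norm_poleTerm_coeff z).mul_left B).of_norm_bounded fun n => ?_
  rw [poleTerm, norm_mul]
  exact mul_le_mul_of_nonneg_right (hB n) (norm_nonneg _)

theorem tsum_auxTerm (h0 : 0 < r) (h1 : r < 1) (hb : Summable fun k => ‖b k‖)
    (ha : ∀ n, (natTower α (n + 1) : ℂ) =
      ∑' k, b k * ((r ^ k : ℝ) : ℂ) * ((r ^ k : ℝ) : ℂ) ^ n) (w : ℂ) :
    ∑' n, auxTerm α w n =
      ∑' k, b k * ((r ^ k : ℝ) : ℂ) * Complex.exp (-(((r ^ k : ℝ) : ℂ) * w)) := by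
  have hg : Summable fun n : ℕ => ‖(-w) ^ n / (n.factorial : ℂ)‖ := by
    refine (Real.summable_pow_div_factorial ‖w‖).congr fun n => ?_
    rw [norm_div, norm_pow, norm_neg, Complex.norm_natCast]
  simp only [auxTerm, ha]
  rw [tsum_tsum_mul_pow_mul (c := fun k => b k * ((r ^ k : ℝ) : ℂ)) (μ := fun k => r ^ k)
    (summable_norm_mul_pow h0 h1 hb) (fun k => by positivity)
    (fun k => pow_le_one₀ h0.le h1.le) hg]
  refine tsum_congr fun k => ?_
  congr 1
  rw [Complex.exp_eq_exp_ℂ, NormedSpace.exp_eq_tsum_div]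
  refine tsum_congr fun n => ?_
  rw [← mul_neg, mul_pow, mul_div_assoc]

theorem tsum_poleTerm (h0 : 0 < r) (h1 : r < 1) (hb : Summable fun k => ‖b k‖)
    (ha : ∀ n, (natTower α (n + 1) : ℂ) =
      ∑' k, b k * ((r ^ k : ℝ) : ℂ) * ((r ^ k : ℝ) : ℂ) ^ n) (z : ℂ) :
    ∑' n, poleTerm α z n = ∑' k, b k * ((r ^ k : ℝ) : ℂ) *
      ∑' n : ℕ, (-((r ^ k : ℝ) : ℂ)) ^ n / ((n.factorial : ℂ) * (n + (1 - z))) := by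
  simp only [poleTerm, ha]
  rw [tsum_tsum_mul_pow_mul (c := fun k => b k * ((r ^ k : ℝ) : ℂ)) (μ := fun k => r ^ k)
    (summable_norm_mul_pow h0 h1 hb) (fun k => by positivity)
    (fun k => pow_le_one₀ h0.le h1.le) (summable_norm_poleTerm_coeff z)]
  refine tsum_congr fun k => ?_
  congr 1
  refine tsum_congr fun n => ?_
  rw [neg_pow ((r ^ k : ℝ) : ℂ) n, add_sub_assoc]
  ring

/-- The bound `q * exp (-(q * w)) ≤ 1 / w`, uniform in `q = r ^ k`, supplies the decay that makes
the tail integrable for every `Re z > 0`. -/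
theorem norm_expTerm_le (h0 : 0 < r) (z : ℂ) (k : ℕ) {w : ℝ} (hw : 0 < w) :
    ‖b k * ((r ^ k : ℝ) : ℂ) * Complex.exp (-(((r ^ k : ℝ) : ℂ) * w)) * (w : ℂ) ^ (-z)‖ ≤
      ‖b k‖ * w ^ (-1 - z.re) := by
  have hx : 0 < r ^ k := by positivity
  have hre : (-(((r ^ k : ℝ) : ℂ) * w)).re = -(r ^ k * w) := by
    rw [← Complex.ofReal_mul, ← Complex.ofReal_neg, Complex.ofReal_re]
  rw [norm_mul, norm_mul, norm_mul, Complex.norm_real, Real.norm_of_nonneg hx.le,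
    Complex.norm_cpow_eq_rpow_re_of_pos hw, Complex.norm_exp, hre, mul_assoc, mul_assoc,
    sub_eq_add_neg, Real.rpow_add hw, Complex.neg_re, ← mul_assoc (r ^ k)]
  have key : r ^ k * Real.exp (-(r ^ k * w)) ≤ w ^ (-1 : ℝ) := by
    rw [Real.rpow_neg_one, Real.exp_neg, ← div_eq_mul_inv, div_le_iff₀ (Real.exp_pos _),
      inv_mul_eq_div, le_div_iff₀ hw]
    linarith [Real.add_one_le_exp (r ^ k * w)]
  gcongr

theorem continuousOn_tsum_expTerm (h0 : 0 < r) (h1 : r < 1) (hb : Summable fun k => ‖b k‖) :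
    ContinuousOn (fun w : ℝ => ∑' k, b k * ((r ^ k : ℝ) : ℂ) *
      Complex.exp (-(((r ^ k : ℝ) : ℂ) * w))) (Set.Ioi 1) := by
  refine continuousOn_tsum (fun k => by fun_prop) (summable_norm_mul_pow h0 h1 hb)
    fun k w hw => ?_
  have hw' : (1 : ℝ) < w := hw
  have hre : (-(((r ^ k : ℝ) : ℂ) * w)).re = -(r ^ k * w) := by
    rw [← Complex.ofReal_mul, ← Complex.ofReal_neg, Complex.ofReal_re]
  rw [norm_mul _ (Complex.exp _), Complex.norm_exp, hre]
  refine mul_le_of_le_one_right (norm_nonneg _) (Real.exp_le_one_iff.2 ?_)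
  have : 0 ≤ r ^ k * w := mul_nonneg (by positivity) (by linarith)
  linarith

theorem integrableOn_expTerm_bound {z : ℂ} (hz : 0 < z.re) :
    IntegrableOn (fun w : ℝ => w ^ (-1 - z.re)) (Set.Ioi 1) :=
  integrableOn_Ioi_rpow_of_lt (by linarith) one_pos

theorem continuousOn_ofReal_cpow_neg (z : ℂ) :
    ContinuousOn (fun w : ℝ => (w : ℂ) ^ (-z)) (Set.Ioi 1) := fun w hw =>
  (Complex.continuousAt_ofReal_cpow_const w _
    (Or.inr (one_pos.trans hw).ne')).continuousWithinAt

theorem integrableOn_tailIntegrand (h0 : 0 < r) (h1 : r < 1) (hb : Summable fun k => ‖b k‖)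
    (ha : ∀ n, (natTower α (n + 1) : ℂ) =
      ∑' k, b k * ((r ^ k : ℝ) : ℂ) * ((r ^ k : ℝ) : ℂ) ^ n) {z : ℂ} (hz : 0 < z.re) :
    IntegrableOn (tailIntegrand α z) (Set.Ioi 1) := by
  unfold tailIntegrand
  simp only [tsum_auxTerm h0 h1 hb ha]
  refine ((integrableOn_expTerm_bound hz).const_mul (∑' k, ‖b k‖)).mono' ?_ ?_
  · exact ((continuousOn_tsum_expTerm h0 h1 hb).mul
      (continuousOn_ofReal_cpow_neg z)).aestronglyMeasurable measurableSet_Ioi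
  · refine (ae_restrict_iff' measurableSet_Ioi).2 (Eventually.of_forall fun w hw => ?_)
    rw [← tsum_mul_right]
    exact tsum_of_norm_bounded (hb.hasSum.mul_right _)
      fun k => norm_expTerm_le h0 z k (one_pos.trans hw)

theorem hasSum_integral_tailIntegrand (h0 : 0 < r) (h1 : r < 1)
    (hb : Summable fun k => ‖b k‖)
    (ha : ∀ n, (natTower α (n + 1) : ℂ) =
      ∑' k, b k * ((r ^ k : ℝ) : ℂ) * ((r ^ k : ℝ) : ℂ) ^ n) {z : ℂ} (hz : 0 < z.re) :
    HasSum (fun k => b k * ((r ^ k : ℝ) : ℂ) * ∫ w in Set.Ioi (1 : ℝ),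
      (w : ℂ) ^ (1 - z - 1) * Complex.exp (-(((r ^ k : ℝ) : ℂ) * w)))
      (∫ w in Set.Ioi (1 : ℝ), tailIntegrand α z w) := by
  unfold tailIntegrand
  simp only [tsum_auxTerm h0 h1 hb ha, ← tsum_mul_right]
  set G : ℕ → ℝ → ℂ := fun k w =>
    b k * ((r ^ k : ℝ) : ℂ) * Complex.exp (-(((r ^ k : ℝ) : ℂ) * w)) * (w : ℂ) ^ (-z) with hG
  have hbound : ∀ k, ∀ w ∈ Set.Ioi (1 : ℝ), ‖G k w‖ ≤ ‖b k‖ * w ^ (-1 - z.re) :=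
    fun k w hw => norm_expTerm_le h0 z k (one_pos.trans hw)
  have hint : ∀ k, IntegrableOn (G k) (Set.Ioi 1) := fun k =>
    ((integrableOn_expTerm_bound hz).const_mul ‖b k‖).mono'
      ((ContinuousOn.mul (by fun_prop) (continuousOn_ofReal_cpow_neg z)).aestronglyMeasurable
        measurableSet_Ioi)
      ((ae_restrict_iff' measurableSet_Ioi).2 (Eventually.of_forall (hbound k)))
  have h := hasSum_integral_of_summable_integral_norm hint
    ((hb.mul_right (∫ w in Set.Ioi (1 : ℝ), w ^ (-1 - z.re))).of_nonneg_of_le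
      (fun k => integral_nonneg fun w => norm_nonneg _) fun k => by
        rw [← integral_const_mul]
        exact setIntegral_mono_on (hint k).norm
          ((integrableOn_expTerm_bound hz).const_mul _) measurableSet_Ioi (hbound k))
  convert! h using 1
  refine funext fun k => Eq.symm ?_
  rw [← integral_const_mul]
  refine integral_congr_ae (Eventually.of_forall fun w => ?_)
  simp only [hG]
  rw [show 1 - z - 1 = -z by ring]
  ring

/-- If the towers are `natTower α n = ∑ b k r ^ (k n)`, the formula sums to `∑ b k r ^ (k z)`. -/
theorem tetrationFormula_eq_tsum (h0 : 0 < r) (h1 : r < 1) (hb : Summable fun k => ‖b k‖)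
    (ha : ∀ n, (natTower α (n + 1) : ℂ) =
      ∑' k, b k * ((r ^ k : ℝ) : ℂ) * ((r ^ k : ℝ) : ℂ) ^ n) {z : ℂ} (hz : 0 < z.re)
    (hz' : ∀ n : ℕ, z ≠ n + 1) :
    tetrationFormula α z = ∑' k, b k * ((r : ℂ) ^ z) ^ k := by
  have hs : ∀ n : ℕ, 1 - z ≠ -n := fun n h => hz' n (by linear_combination -h)
  have hQ := hasSum_integral_tailIntegrand h0 h1 hb ha hz
  have hμ : ∀ k : ℕ, 0 < r ^ k := fun k => by positivity
  have hμ1 : ∀ k : ℕ, r ^ k ≤ 1 := fun k => pow_le_one₀ h0.le h1.le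
  -- The Gamma identity is solved for the series part, so that the integral parts cancel after
  -- summation over `k`.
  have hterm : ∀ k : ℕ, b k * ((r ^ k : ℝ) : ℂ) * ∑' n : ℕ, (-((r ^ k : ℝ) : ℂ)) ^ n /
        ((n.factorial : ℂ) * (n + (1 - z))) =
      Complex.Gamma (1 - z) * (b k * ((r : ℂ) ^ z) ^ k) -
        b k * ((r ^ k : ℝ) : ℂ) * ∫ w in Set.Ioi (1 : ℝ),
          (w : ℂ) ^ (1 - z - 1) * Complex.exp (-(((r ^ k : ℝ) : ℂ) * w)) := fun k => by
    have hne : ((r ^ k : ℝ) : ℂ) ≠ 0 := by exact_mod_cast (hμ k).ne'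
    have h := tsum_add_integral_Ioi_one_eq_Gamma hs (hμ k) (hμ1 k)
    have e : ((r ^ k : ℝ) : ℂ) * ((r ^ k : ℝ) : ℂ) ^ (-(1 - z)) = ((r : ℂ) ^ z) ^ k := by
      rw [← ofReal_pow_cpow h0.le, neg_sub, Complex.cpow_sub _ _ hne, Complex.cpow_one,
        mul_div_cancel₀ _ hne]
    rw [← e]
    linear_combination (b k * ((r ^ k : ℝ) : ℂ)) * h
  have hF : Summable fun k => b k * ((r : ℂ) ^ z) ^ k := by
    refine hb.of_norm_bounded fun k => ?_
    rw [norm_mul, norm_pow, Complex.norm_cpow_eq_rpow_re_of_pos h0]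
    exact mul_le_of_le_one_right (norm_nonneg _)
      (pow_le_one₀ (Real.rpow_nonneg h0.le _) (Real.rpow_le_one h0.le h1.le hz.le))
  rw [tetrationFormula, tsum_poleTerm h0 h1 hb ha]
  simp only [hterm]
  rw [(hF.mul_left _).tsum_sub hQ.summable, hQ.tsum_eq, sub_add_cancel, tsum_mul_left,
    ← mul_assoc, one_div, inv_mul_cancel₀ (Complex.Gamma_ne_zero hs), one_mul]

end Series

/-! ### The fixed point and the towers in linearised form -/

section Tower

variable {α : ℝ}

theorem exists_fixedPoint (hα : 1 < α) (hα' : α < Real.exp (1 / Real.exp 1)) :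
    ∃ ω : ℝ, 1 < ω ∧ Real.log α * ω < 1 ∧ Real.exp (Real.log α * ω) = ω := by
  have hL : 0 < Real.log α := Real.log_pos hα
  have hL' : Real.log α * Real.exp 1 < 1 := by
    rw [← lt_div_iff₀ (Real.exp_pos 1)]
    exact (Real.log_lt_iff_lt_exp (by linarith)).2 hα'
  have he : (1 : ℝ) ≤ Real.exp 1 := Real.one_le_exp zero_le_one
  have hcont : ContinuousOn (fun x => Real.log α * x - Real.log x) (Set.Icc 1 (Real.exp 1)) :=
    (continuousOn_const.mul continuousOn_id).sub
      (Real.continuousOn_log.mono fun x hx => (zero_lt_one.trans_le hx.1).ne')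
  -- At the endpoints `1` and `e` the values are `log α > 0` and `e * log α - 1 < 0`; the bound `ω <
  -- e` then makes the multiplier less than `1`.
  obtain ⟨ω, hω, h⟩ := intermediate_value_Ioo' he hcont
    (show (0 : ℝ) ∈ Set.Ioo _ _ by simp; constructor <;> linarith)
  have hpos : 0 < ω := by linarith [hω.1]
  refine ⟨ω, hω.1, (mul_lt_mul_of_pos_left hω.2 hL).trans hL', ?_⟩
  rw [sub_eq_zero.1 h, Real.exp_log hpos]

theorem natTower_eq (hα : 1 < α) {ω : ℝ} (hω : 1 < ω)
    (hfix : Real.exp (Real.log α * ω) = ω) (n : ℕ) :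
    natTower α n = ω * (1 - (expStep (Real.log α * ω))^[n] (1 - 1 / ω)) := by
  have h0 : ω ≠ 0 := by linarith
  induction n with
  | zero => simp [natTower, h0]
  | succ n ih =>
    rw [natTower, Function.iterate_succ_apply', expStep, ih, sub_sub_cancel,
      Real.rpow_def_of_pos (by linarith)]
    set X := (expStep (Real.log α * ω))^[n] (1 - 1 / ω)
    rw [show Real.log α * (ω * (1 - X)) = Real.log α * ω + -(Real.log α * ω * X) by ring,
      Real.exp_add, hfix]

/-- The series `∑ bₖ qᵏ` with `b` built from the Koenigs coefficients. -/
theorem hasSum_koenigs {r T : ℝ} (h0 : 0 < r) (h1 : r < 1)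
    (hs : Summable fun k => koenigsCoeff r k * T ^ k) (ω : ℝ) {q : ℂ} (hT : 0 ≤ T)
    (hq : ‖q‖ ≤ 1) :
    HasSum (fun k => (ω : ℂ) * ((if k = 0 then 1 else 0) -
      (koenigsCoeff r k : ℂ) * (T : ℂ) ^ k) * q ^ k)
      (ω * (1 - koenigsFun r (q * T))) := by
  have hle : ‖q * (T : ℂ)‖ ≤ T := by
    rw [norm_mul, Complex.norm_real, Real.norm_of_nonneg hT]
    exact mul_le_of_le_one_left hT hq
  have hH : HasSum (fun k => (koenigsCoeff r k : ℂ) * (q * T) ^ k) (koenigsFun r (q * T)) :=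
    (hs.of_norm_bounded (norm_koenigsCoeff_mul_pow_le h0 h1 hle)).hasSum
  have hone : HasSum (fun k : ℕ => if k = 0 then (1 : ℂ) else 0) 1 := hasSum_ite_eq 0 1
  convert! (hone.sub hH).mul_left (ω : ℂ) using 1
  refine funext fun k => Eq.symm ?_
  rw [mul_pow]
  split_ifs with hk
  · simp [hk]
  · ring

end Tower

end

theorem mainTheorem3 (α : ℝ) (hα : 1 < α) (hα' : α < Real.exp (1 / Real.exp 1)) :
    -- the series and the integral in the formula converge (absolutely)
    (∀ w : ℂ, Summable (auxTerm α w)) ∧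
    (∀ z ∈ rightHalfPlane, (∀ n : ℕ, z ≠ (n : ℂ) + 1) → Summable (poleTerm α z)) ∧
    (∀ z ∈ rightHalfPlane, IntegrableOn (tailIntegrand α z) (Set.Ioi (1 : ℝ)) volume) ∧
    -- the formula, with its removable singularities at `z = 1, 2, 3, …` filled in, is a
    -- tetration function base `α`, and it interpolates the natural towers
    ∃ F : ℂ → ℂ,
      (∀ z ∈ rightHalfPlane, (∀ n : ℕ, z ≠ (n : ℂ) + 1) → F z = tetrationFormula α z) ∧
      IsTetrationFunction α F ∧
      (∀ n : ℕ, F ((n : ℂ) + 1) = (natTower α (n + 1) : ℂ)) := by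
  obtain ⟨ω, hω, h1, hfix⟩ := exists_fixedPoint hα hα'
  have hω0 : 0 < ω := by linarith
  have htower := natTower_eq hα hω hfix
  set r := Real.log α * ω with hr
  have h0 : 0 < r := mul_pos (Real.log_pos hα) hω0
  set x := 1 - 1 / ω with hx
  have hx0 : 0 < x := sub_pos.2 ((div_lt_one hω0).2 hω)
  obtain ⟨T, hT, hlim, hle⟩ := exists_tendsto_iterate_expStep h0 h1 hx0
  have hs := summable_koenigsCoeff h0 h1 hx0.le hT hle
  set b : ℕ → ℂ := fun k => (ω : ℂ) * ((if k = 0 then 1 else 0) -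
    (koenigsCoeff r k : ℂ) * (T : ℂ) ^ k) with hbdef
  have hb : Summable fun k => ‖b k‖ := by
    have := (hasSum_koenigs h0 h1 hs ω (q := 1) hT.le (by simp)).summable.norm
    simpa only [one_pow, mul_one] using this
  -- This closed form is holomorphic also at `z = 1, 2, 3, …`, so it fills in the removable
  -- singularities.
  set F : ℂ → ℂ := fun z => ω * (1 - koenigsFun r ((r : ℂ) ^ z * T)) with hF
  have hpow_tower : ∀ n : ℕ,
      (ω : ℂ) * (1 - koenigsFun r ((r : ℂ) ^ n * T)) = (natTower α n : ℂ) := fun n => by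
    rw [koenigsFun_pow_mul h0 h1 hx0.le hT hlim hle, htower]
    push_cast
    rfl
  have hFnat : ∀ n : ℕ, F ((n : ℂ) + 1) = (natTower α (n + 1) : ℂ) := fun n => by
    rw [← hpow_tower, ← Complex.cpow_natCast, Nat.cast_add, Nat.cast_one]
  have ha : ∀ n, (natTower α (n + 1) : ℂ) =
      ∑' k, b k * ((r ^ k : ℝ) : ℂ) * ((r ^ k : ℝ) : ℂ) ^ n := fun n => by
    have hq : ‖(r : ℂ) ^ (n + 1)‖ ≤ 1 := by
      rw [norm_pow, Complex.norm_real, Real.norm_of_nonneg h0.le]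
      exact pow_le_one₀ h0.le h1.le
    rw [← hpow_tower, ← (hasSum_koenigs h0 h1 hs ω hT.le hq).tsum_eq]
    refine tsum_congr fun k => ?_
    push_cast
    rw [mul_assoc (b k), ← pow_succ', ← pow_mul, ← pow_mul, mul_comm k]
  have hB := norm_natTower_le h0 h1 hb ha
  have hlt : ∀ z : ℂ, 0 < z.re → ‖(r : ℂ) ^ z‖ < 1 := fun z hz => by
    rw [Complex.norm_cpow_eq_rpow_re_of_pos h0]
    exact Real.rpow_lt_one h0.le h1 hz
  -- For `Re z > 0` the argument of `koenigsFun` stays in the open disc, where holomorphy and the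
  -- Schröder equation hold.
  have hltT : ∀ z : ℂ, 0 < z.re → ‖(r : ℂ) ^ z * T‖ < T := fun z hz => by
    rw [norm_mul, Complex.norm_real, Real.norm_of_nonneg hT.le]
    exact mul_lt_of_lt_one_left hT (hlt z hz)
  have hr0 : (r : ℂ) ≠ 0 := by exact_mod_cast h0.ne'
  refine ⟨summable_auxTerm hB, fun z _ _ => summable_poleTerm hB z,
    fun z hz => integrableOn_tailIntegrand h0 h1 hb ha hz, F, fun z hz hz' => ?_,
    ⟨fun z hz => ?_, ?_, fun z hz => ?_⟩, hFnat⟩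
  · rw [tetrationFormula_eq_tsum h0 h1 hb ha hz hz',
      (hasSum_koenigs h0 h1 hs ω hT.le (hlt z hz).le).tsum_eq]
  · have hd : DifferentiableAt ℂ (koenigsFun r) ((r : ℂ) ^ z * T) :=
      (differentiableOn_koenigsFun h0 h1 hs).differentiableAt
        (Metric.isOpen_ball.mem_nhds (mem_ball_zero_iff.2 (hltT z hz)))
    have hg : DifferentiableAt ℂ (fun z : ℂ => (r : ℂ) ^ z * T) z :=
      (differentiableAt_id.const_cpow (Or.inl hr0)).mul_const _
    exact (((hd.comp z hg).const_sub 1).const_mul _).differentiableWithinAt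
  · simpa [natTower] using hFnat 0
  · have hα0 : (α : ℂ) ≠ 0 := by exact_mod_cast (by linarith : α ≠ 0)
    -- With `exp r = ω`, the Schröder equation for `koenigsFun` becomes `F (z + 1) = α ^ F z`.
    have hexp : Complex.exp r = ω := by rw [← Complex.ofReal_exp, hfix]
    simp only [hF]
    rw [Complex.cpow_add _ _ hr0, Complex.cpow_one, mul_comm ((r : ℂ) ^ z), mul_assoc,
      koenigsFun_mul h0 h1 hs (hltT z hz), sub_sub_cancel, Complex.cpow_def_of_ne_zero hα0,
      ← Complex.ofReal_log (by linarith)]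
    rw [show (Real.log α : ℂ) * (ω * (1 - koenigsFun r ((r : ℂ) ^ z * T))) =
      r + -(r * koenigsFun r ((r : ℂ) ^ z * T)) by rw [hr]; push_cast; ring, Complex.exp_add, hexp]
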